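/- Let $n,t$ be natural numbers and write $\mathbb R[\bar X]=\mathbb R[X_1,\dots,X_n]$. For a commutative ring $A$ and $G\subseteq A$, the quadratic module generated by $G$ in $A$ (with the trivial involution) is the set of all finite sums $\sum_{i=1}^N p_i^2g_i$ with $p_i\in A$ and $g_i\in\{1\}\cup G$, and a quadratic module $Q\subseteq A$ is archimedean if for every $a\in A$ there is a natural number $N$ with $N-a^2\in Q$. Let $G\subseteq\mathbb R[\bar X]$ be a (possibly infinite) set of polynomials such that the quadratic module $Q_G$ generated by $G$ in $\mathbb R[\bar X]$ is archimedean, let $S_G=\{x\in\mathbb R^n\mid g(x)\ge 0\text{ for all }g\in G\}$, and let $f\in\mathbb R[\bar X]^{t\times t}$ be a matrix polynomial, not necessarily symmetric. Let $\mathbb R[\bar X,f]$ be the commutative subring of $\mathbb R[\bar X]^{t\times t}$ generated by the scalar matrices $p\cdot I_t$ $(p\in\mathbb R[\bar X])$ and $f$, and let $Q_G^f$ be the quadratic module generated by (the image $\{g\cdot I_t\mid g\in G\}$ of) $G$ in the commutative ring $\mathbb R[\bar X,f]$. If for all $x\in S_G$ all real eigenvalues of $f(x)$ are positive, then $f\in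 Q_G^f$. -/

import Mathlib

/-- A quadratic module in a commutative ring `A`, where `A` carries the trivial involution
`a ↦ a`: it contains `1`, is closed under addition and under multiplication by squares. -/
structure IsQuadraticModule {A : Type*} [CommRing A] (Q : Set A) : Prop where
  one_mem : (1 : A) ∈ Q
  add_mem : ∀ {a b : A}, a ∈ Q → b ∈ Q → a + b ∈ Q
  sq_mul_mem : ∀ (c : A) {a : A}, a ∈ Q → c ^ 2 * a ∈ Q

/-- The quadratic module generated by `G` in a commutative ring `A` with the trivial involution:
all finite sums `∑ pᵢ² gᵢ` with `gᵢ ∈ {1} ∪ G` and `pᵢ ∈ A`. -/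
def quadraticModuleGeneratedBy {A : Type*} [CommRing A] (G : Set A) : Set A :=
  {a | ∃ (N : ℕ) (p g : Fin N → A),
    (∀ i, g i ∈ ({1} : Set A) ∪ G) ∧ a = ∑ i, p i ^ 2 * g i}

/-- The set of sums above is the smallest quadratic module containing `G`. -/
theorem isLeast_quadraticModuleGeneratedBy {A : Type*} [CommRing A] (G : Set A) :
    IsLeast {Q : Set A | IsQuadraticModule Q ∧ G ⊆ Q} (quadraticModuleGeneratedBy G) := by
  refine ⟨⟨⟨?_, ?_, ?_⟩, ?_⟩, ?_⟩
  · exact ⟨1, fun _ => 1, fun _ => 1, by simp, by simp⟩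
  · rintro a b ⟨N, p, g, hg, rfl⟩ ⟨M, q, h, hh, rfl⟩
    refine ⟨N + M, Fin.append p q, Fin.append g h, fun i => ?_, ?_⟩
    · refine Fin.addCases (fun i => ?_) (fun i => ?_) i
      · simpa using hg i
      · simpa using hh i
    · simp [Fin.sum_univ_add]
  · rintro c a ⟨N, p, g, hg, rfl⟩
    refine ⟨N, fun i => c * p i, g, hg, ?_⟩
    rw [Finset.mul_sum]
    exact Finset.sum_congr rfl fun i _ => by ring
  · intro a ha
    exact ⟨1, fun _ => 1, fun _ => a, fun _ => Or.inr ha, by simp⟩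
  · rintro Q ⟨hQ, hG⟩ a ⟨N, p, g, hg, rfl⟩
    have h0 : (0 : A) ∈ Q := by simpa using hQ.sq_mul_mem 0 hQ.one_mem
    refine Finset.sum_induction _ (· ∈ Q) (fun _ _ => hQ.add_mem) h0 fun i _ => ?_
    refine hQ.sq_mul_mem _ ?_
    rcases hg i with h | h
    · rw [Set.mem_singleton_iff.1 h]
      exact hQ.one_mem
    · exact hG h

/-- A quadratic module `Q` in a commutative ring `A` (with the trivial involution) is archimedean
if for every `a ∈ A` there is a natural number `N` with `N - a² ∈ Q`. -/
def IsArchimedeanQuadraticModule {A : Type*} [CommRing A] (Q : Set A) : Prop :=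
  IsQuadraticModule Q ∧ ∀ a : A, ∃ N : ℕ, (N : A) - a ^ 2 ∈ Q

/-- The set `S_G` of the points of `ℝⁿ` at which all polynomials in `G` are nonnegative. -/
def nonnegSet {n : ℕ} (G : Set (MvPolynomial (Fin n) ℝ)) : Set (Fin n → ℝ) :=
  {x | ∀ g ∈ G, 0 ≤ MvPolynomial.eval x g}

/-- The real matrix `f(x)` obtained by evaluating the entries of a matrix polynomial `f`. -/
noncomputable def evalMatrix {n t : ℕ} (f : Matrix (Fin t) (Fin t) (MvPolynomial (Fin n) ℝ))
    (x : Fin n → ℝ) : Matrix (Fin t) (Fin t) ℝ :=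
  f.map (MvPolynomial.eval x)

/-- The commutative ring `ℝ[X, f]`: the subring of the ring of `t × t` matrix polynomials
that is generated by the scalar matrices `p • 1`, `p ∈ ℝ[X]`, and by `f`. -/
noncomputable abbrev polyRingAdjoin {n t : ℕ}
    (f : Matrix (Fin t) (Fin t) (MvPolynomial (Fin n) ℝ)) :
    Subalgebra (MvPolynomial (Fin n) ℝ)
      (Matrix (Fin t) (Fin t) (MvPolynomial (Fin n) ℝ)) :=
  Algebra.adjoin (MvPolynomial (Fin n) ℝ) {f}

/-- `Q_G^f`: the quadratic module generated by (the image of) `G` in the commutative ring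
`ℝ[X, f]` with the trivial involution. -/
noncomputable def quadraticModuleAdjoin {n t : ℕ} (G : Set (MvPolynomial (Fin n) ℝ))
    (f : Matrix (Fin t) (Fin t) (MvPolynomial (Fin n) ℝ)) : Set (polyRingAdjoin f) :=
  quadraticModuleGeneratedBy
    (algebraMap (MvPolynomial (Fin n) ℝ) (polyRingAdjoin f) '' G)

/-! The ring `ℝ[X, f]` is commutative and, every matrix being a root of its characteristic
polynomial, integral over `ℝ[X]`. Boundedness of squares passes to integral extensions: a monic
equation with bounded coefficients bounds its root. Hence `Q_G^f` is archimedean, and Jacobi's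
representation theorem applies: `f` lies in it once every real point `φ` nonnegative on it satisfies
`0 < φ f`. Such a `φ` restricts to evaluation at some `x ∈ S_G`, and by Cayley–Hamilton `φ f` is a
root of the characteristic polynomial of `f(x)`, hence a positive eigenvalue.

Jacobi's theorem rests on two facts: a maximal proper archimedean module comes from a real point,
which yields an identity `s f = 1 + q` with `s` a sum of squares and `q ∈ Q`; and such an identity
already forces `f ∈ Q`. -/

namespace IsQuadraticModule

variable {A : Type*} [CommRing A] {Q : Set A}

theorem zero_mem (hQ : IsQuadraticModule Q) : (0 : A) ∈ Q := by
  simpa using hQ.sq_mul_mem 0 hQ.one_mem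

theorem sum_mem (hQ : IsQuadraticModule Q) {ι : Type*} {s : Finset ι} {g : ι → A}
    (hg : ∀ i ∈ s, g i ∈ Q) : ∑ i ∈ s, g i ∈ Q :=
  Finset.sum_induction _ (· ∈ Q) (fun _ _ => hQ.add_mem) hQ.zero_mem hg

theorem isSumSq_mul_mem (hQ : IsQuadraticModule Q) {s a : A} (hs : IsSumSq s) (ha : a ∈ Q) :
    s * a ∈ Q := by
  induction hs with
  | zero => simpa using hQ.zero_mem
  | sq_add b _ ih =>
    rw [add_mul, ← sq]
    exact hQ.add_mem (hQ.sq_mul_mem b ha) ih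

theorem isSumSq_mem (hQ : IsQuadraticModule Q) {s : A} (hs : IsSumSq s) : s ∈ Q := by
  simpa using hQ.isSumSq_mul_mem hs hQ.one_mem

theorem sq_mem (hQ : IsQuadraticModule Q) (a : A) : a ^ 2 ∈ Q := by
  simpa using hQ.sq_mul_mem a hQ.one_mem

theorem natCast_mul_mem (hQ : IsQuadraticModule Q) (m : ℕ) {a : A} (ha : a ∈ Q) :
    (m : A) * a ∈ Q := by
  rw [← nsmul_eq_mul, ← Finset.card_range m, ← Finset.sum_const]
  exact hQ.sum_mem fun _ _ => ha

theorem natCast_mem (hQ : IsQuadraticModule Q) (m : ℕ) : (m : A) ∈ Q := by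
  simpa using hQ.natCast_mul_mem m hQ.one_mem

/-- The quadratic module generated by a quadratic module and one further element. -/
theorem adjoin (hQ : IsQuadraticModule Q) (a : A) :
    IsQuadraticModule {x | ∃ q ∈ Q, ∃ s, IsSumSq s ∧ x = q + s * a} where
  one_mem := ⟨1, hQ.one_mem, 0, IsSumSq.zero, by simp⟩
  add_mem := by
    rintro _ _ ⟨q, hq, s, hs, rfl⟩ ⟨q', hq', s', hs', rfl⟩
    exact ⟨q + q', hQ.add_mem hq hq', s + s', hs.add hs', by ring⟩
  sq_mul_mem := by
    rintro c _ ⟨q, hq, s, hs, rfl⟩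
    refine ⟨c ^ 2 * q, hQ.sq_mul_mem c hq, c ^ 2 * s, ?_, by ring⟩
    rw [sq]
    exact (IsSumSq.mul_self c).mul hs

theorem exists_maximal (hQ : IsQuadraticModule Q) (h1 : (-1 : A) ∉ Q) :
    ∃ P, Q ⊆ P ∧ Maximal (fun P : Set A => IsQuadraticModule P ∧ (-1 : A) ∉ P) P := by
  refine zorn_subset_nonempty {P : Set A | IsQuadraticModule P ∧ (-1 : A) ∉ P} ?_ Q ⟨hQ, h1⟩
  rintro C hC hchain ⟨P₀, hP₀⟩
  refine ⟨⋃₀ C, ⟨⟨⟨P₀, hP₀, (hC hP₀).1.one_mem⟩, ?_, ?_⟩, ?_⟩, fun _ => Set.subset_sUnion_of_mem⟩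
  · rintro a b ⟨P, hP, ha⟩ ⟨P', hP', hb⟩
    rcases hchain.total hP hP' with h | h
    · exact ⟨P', hP', (hC hP').1.add_mem (h ha) hb⟩
    · exact ⟨P, hP, (hC hP).1.add_mem ha (h hb)⟩
  · rintro c a ⟨P, hP, ha⟩
    exact ⟨P, hP, (hC hP).1.sq_mul_mem c ha⟩
  · rintro ⟨P, hP, h⟩
    exact (hC hP).2 h

variable [Algebra ℝ A]

theorem algebraMap_mul_mem (hQ : IsQuadraticModule Q) {r : ℝ} (hr : 0 ≤ r) {a : A} (ha : a ∈ Q) :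
    algebraMap ℝ A r * a ∈ Q := by
  rw [← Real.sq_sqrt hr, map_pow]
  exact hQ.sq_mul_mem _ ha

theorem algebraMap_mem (hQ : IsQuadraticModule Q) {r : ℝ} (hr : 0 ≤ r) :
    algebraMap ℝ A r ∈ Q := by
  simpa using hQ.algebraMap_mul_mem hr hQ.one_mem

theorem mem_of_algebraMap_mul_mem (hQ : IsQuadraticModule Q) {r : ℝ} (hr : 0 < r) {a : A}
    (ha : algebraMap ℝ A r * a ∈ Q) : a ∈ Q := by
  have h := hQ.algebraMap_mul_mem (inv_nonneg.2 hr.le) ha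
  rwa [← mul_assoc, ← map_mul, inv_mul_cancel₀ hr.ne', map_one, one_mul] at h

/-- The support `Q ∩ -Q` of a quadratic module is closed under multiplication. -/
theorem mul_mem_of_mem_support (hQ : IsQuadraticModule Q) {a : A} (ha : a ∈ Q) (ha' : -a ∈ Q)
    (b : A) : b * a ∈ Q := by
  have h : 2 * algebraMap ℝ A (1 / 2) = 1 := by
    rw [← map_ofNat (algebraMap ℝ A) 2, ← map_mul]
    norm_num
  -- Polarisation: `4b = (b + 1)² - (b - 1)²`.
  have key : b * a = (algebraMap ℝ A (1 / 2) * (b + 1)) ^ 2 * a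
      + (algebraMap ℝ A (1 / 2) * (b - 1)) ^ 2 * (-a) := by
    linear_combination (-(b * a) * (2 * algebraMap ℝ A (1 / 2) + 1)) * h
  rw [key]
  exact hQ.add_mem (hQ.sq_mul_mem _ ha) (hQ.sq_mul_mem _ ha')

/-- If neither sign belongs, maximality gives `-1 = q + s a` and `-1 = q' - s' a`. Eliminating `a`
puts `s` in the support, hence `s a ∈ Q` and `-1 ∈ Q`. -/
theorem mem_or_neg_mem_of_maximal
    (hQ : Maximal (fun P : Set A => IsQuadraticModule P ∧ (-1 : A) ∉ P) Q) (a : A) :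
    a ∈ Q ∨ -a ∈ Q := by
  have hQm := hQ.prop.1
  have key : ∀ b : A, b ∉ Q → ∃ q ∈ Q, ∃ s, IsSumSq s ∧ (-1 : A) = q + s * b := by
    intro b hb
    by_contra hcon
    refine hb (hQ.le_of_ge ⟨hQm.adjoin b, hcon⟩ (fun q hq => ⟨q, hq, 0, IsSumSq.zero, by simp⟩)
      ⟨0, hQm.zero_mem, 1, by simp, by simp⟩)
  by_contra! hcon
  obtain ⟨q, hq, s, hs, h⟩ := key a hcon.1
  obtain ⟨q', hq', s', hs', h'⟩ := key (-a) hcon.2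
  have hneg : -s ∈ Q := by
    have e : -s = s' + (s' * q + s * q') := by linear_combination s' * h + s * h'
    rw [e]
    exact hQm.add_mem (hQm.isSumSq_mem hs')
      (hQm.add_mem (hQm.isSumSq_mul_mem hs' hq) (hQm.isSumSq_mul_mem hs hq'))
  apply hQ.prop.2
  rw [h, mul_comm s a]
  exact hQm.add_mem hq (hQm.mul_mem_of_mem_support (hQm.isSumSq_mem hs) hneg a)

/-- The set of elements that become members after adding any positive real is again a quadratic
module, provided that squares are bounded. -/
theorem archimedeanClosure (hQ : IsArchimedeanQuadraticModule Q) :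
    IsQuadraticModule {a : A | ∀ ε : ℝ, 0 < ε → a + algebraMap ℝ A ε ∈ Q} where
  one_mem := fun _ hε => hQ.1.add_mem hQ.1.one_mem (hQ.1.algebraMap_mem hε.le)
  add_mem := by
    intro a b ha hb ε hε
    have e : a + b + algebraMap ℝ A ε
        = (a + algebraMap ℝ A (ε / 2)) + (b + algebraMap ℝ A (ε / 2)) := by
      rw [← add_halves ε, map_add]
      simp only [add_halves]
      ring
    rw [e]
    exact hQ.1.add_mem (ha _ (half_pos hε)) (hb _ (half_pos hε))
  sq_mul_mem := by
    intro c a ha ε hε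
    obtain ⟨N, hN⟩ := hQ.2 c
    have hN1 : (0 : ℝ) < N + 1 := by positivity
    have hd : 0 < ε / (N + 1) := div_pos hε hN1
    have e1 : algebraMap ℝ A ε = algebraMap ℝ A (ε / (N + 1)) * (N + 1) := by
      rw [← map_natCast (algebraMap ℝ A) N, ← map_one (algebraMap ℝ A), ← map_add, ← map_mul,
        div_mul_cancel₀ _ hN1.ne']
    have e : c ^ 2 * a + algebraMap ℝ A ε = c ^ 2 * (a + algebraMap ℝ A (ε / (N + 1)))
        + algebraMap ℝ A (ε / (N + 1)) * ((N - c ^ 2) + 1) := by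
      rw [e1]
      ring
    rw [e]
    exact hQ.1.add_mem (hQ.1.sq_mul_mem c (ha _ hd))
      (hQ.1.algebraMap_mul_mem hd.le (hQ.1.add_mem hN hQ.1.one_mem))

end IsQuadraticModule

/-! ### Real points and Jacobi's representation theorem -/

namespace IsArchimedeanQuadraticModule

variable {A : Type*} [CommRing A] [Algebra ℝ A] {Q : Set A}

omit [Algebra ℝ A] in
theorem mono (hQ : IsArchimedeanQuadraticModule Q) {P : Set A} (hP : IsQuadraticModule P)
    (h : Q ⊆ P) : IsArchimedeanQuadraticModule P :=
  ⟨hP, fun a => (hQ.2 a).imp fun _ hN => h hN⟩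

theorem exists_natCast_sub_mem (hQ : IsArchimedeanQuadraticModule Q) (a : A) :
    ∃ N : ℕ, (N : A) - a ∈ Q := by
  obtain ⟨N, hN⟩ := hQ.2 a
  have h : 2 * algebraMap ℝ A (1 / 2) = 1 := by
    rw [← map_ofNat (algebraMap ℝ A) 2, ← map_mul]
    norm_num
  have h3 : 4 * algebraMap ℝ A (3 / 4) = 3 := by
    rw [← map_ofNat (algebraMap ℝ A) 4, ← map_mul, ← map_ofNat (algebraMap ℝ A) 3]
    norm_num
  refine ⟨N + 1, ?_⟩
  have e : ((N + 1 : ℕ) : A) - a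
      = (N - a ^ 2) + ((a - algebraMap ℝ A (1 / 2)) ^ 2 + algebraMap ℝ A (3 / 4)) := by
    have h4 : (algebraMap ℝ A (1 / 2)) ^ 2 + algebraMap ℝ A (3 / 4) = 1 := by
      rw [← map_pow, ← map_add, ← map_one (algebraMap ℝ A)]
      norm_num
    push_cast
    linear_combination a * h - h4
  rw [e]
  exact hQ.1.add_mem hN (hQ.1.add_mem (hQ.1.sq_mem _) (hQ.1.algebraMap_mem (by norm_num)))

/-- A total proper archimedean quadratic module is contained in the nonnegativity set of a
real point. -/
theorem exists_ringHom_of_total (hQ : IsArchimedeanQuadraticModule Q) (h1 : (-1 : A) ∉ Q)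
    (htot : ∀ a, a ∈ Q ∨ -a ∈ Q) : ∃ φ : A →ₐ[ℝ] ℝ, ∀ a ∈ Q, 0 ≤ φ a := by
  have hC := IsQuadraticModule.archimedeanClosure hQ
  set C : Set A := {a : A | ∀ ε : ℝ, 0 < ε → a + algebraMap ℝ A ε ∈ Q} with hCdef
  have hQC : Q ⊆ C := fun a ha ε hε => hQ.1.add_mem ha (hQ.1.algebraMap_mem hε.le)
  have hreal : ∀ r : ℝ, algebraMap ℝ A r ∈ Q → 0 ≤ r := by
    intro r hr
    by_contra! hneg
    apply h1
    refine hQ.1.mem_of_algebraMap_mul_mem (neg_pos.2 hneg) ?_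
    simpa using hr
  have hrealC : ∀ r : ℝ, algebraMap ℝ A r ∈ C → 0 ≤ r := by
    intro r hr
    refine le_of_forall_pos_le_add fun ε hε => hreal _ ?_
    rw [map_add]
    exact hr ε hε
  -- The support of the closure `C` will be the kernel of the point; `C` replaces `Q` because the
  -- infimum below need not be attained in `Q`.
  let I : Ideal A :=
    { carrier := {a | a ∈ C ∧ -a ∈ C}
      add_mem' := by
        rintro a b ⟨ha, ha'⟩ ⟨hb, hb'⟩
        exact ⟨hC.add_mem ha hb, by rw [neg_add]; exact hC.add_mem ha' hb'⟩
      zero_mem' := ⟨hC.zero_mem, by rw [neg_zero]; exact hC.zero_mem⟩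
      smul_mem' := by
        rintro b a ⟨ha, ha'⟩
        refine ⟨hC.mul_mem_of_mem_support ha ha' b, ?_⟩
        rw [smul_eq_mul, ← neg_mul]
        exact hC.mul_mem_of_mem_support ha ha' (-b) }
  have hI : ∀ a, a ∈ I ↔ a ∈ C ∧ -a ∈ C := fun _ => Iff.rfl
  have hex : ∀ a : A, ∃ r : ℝ, a - algebraMap ℝ A r ∈ I := by
    intro a
    let U : Set ℝ := {r | algebraMap ℝ A r - a ∈ Q}
    obtain ⟨N, hN⟩ := hQ.exists_natCast_sub_mem a
    obtain ⟨M, hM⟩ := hQ.exists_natCast_sub_mem (-a)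
    have hne : U.Nonempty := ⟨N, by simpa [U] using hN⟩
    have hbd : BddBelow U := by
      refine ⟨-M, fun r hr => ?_⟩
      have := hreal (r + M) (by
        have := hQ.1.add_mem hr hM
        simpa using this)
      linarith
    -- The value of `a` is a Dedekind cut: below the infimum, totality supplies the reverse
    -- inequality.
    refine ⟨sInf U, fun ε hε => ?_, fun ε hε => ?_⟩
    · have hnot : sInf U - ε ∉ U := fun h => by
        have := csInf_le hbd h
        linarith
      have := (htot (algebraMap ℝ A (sInf U - ε) - a)).resolve_left hnot
      convert this using 1
      rw [map_sub]
      ring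
    · obtain ⟨r, hr, hlt⟩ := exists_lt_of_csInf_lt hne (lt_add_of_pos_right (sInf U) hε)
      have := hQ.1.add_mem hr (hQ.1.algebraMap_mem (sub_nonneg.2 hlt.le))
      convert this using 1
      simp only [map_sub, map_add]
      ring
  have hbij : Function.Bijective (Algebra.ofId ℝ (A ⧸ I)) := by
    constructor
    · rw [injective_iff_map_eq_zero]
      intro r hr
      have hr' : Ideal.Quotient.mk I (algebraMap ℝ A r) = 0 := hr
      rw [Ideal.Quotient.eq_zero_iff_mem, hI, ← map_neg] at hr'
      have h₁ := hrealC _ hr'.1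
      have h₂ := hrealC _ hr'.2
      linarith
    · intro x
      obtain ⟨a, rfl⟩ := Ideal.Quotient.mk_surjective x
      obtain ⟨r, hr⟩ := hex a
      exact ⟨r, ((Ideal.Quotient.eq).2 hr).symm⟩
  let e := AlgEquiv.ofBijective (Algebra.ofId ℝ (A ⧸ I)) hbij
  refine ⟨(e.symm : (A ⧸ I) →ₐ[ℝ] ℝ).comp (Ideal.Quotient.mkₐ ℝ I), fun a ha => ?_⟩
  obtain ⟨r, hr⟩ := hex a
  have hφ : e.symm (Ideal.Quotient.mk I a) = r := by
    rw [AlgEquiv.symm_apply_eq]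
    exact (Ideal.Quotient.eq).2 hr
  change 0 ≤ e.symm (Ideal.Quotient.mk I a)
  rw [hφ]
  apply hrealC
  have := hC.add_mem (hQC ha) hr.2
  simpa using this

theorem exists_ringHom (hQ : IsArchimedeanQuadraticModule Q) {P : Set A}
    (hP : IsQuadraticModule P) (hQP : Q ⊆ P) (h1 : (-1 : A) ∉ P) :
    ∃ φ : A →ₐ[ℝ] ℝ, ∀ a ∈ P, 0 ≤ φ a := by
  obtain ⟨M, hPM, hM⟩ := hP.exists_maximal h1
  obtain ⟨φ, hφ⟩ := (hQ.mono hM.prop.1 (hQP.trans hPM)).exists_ringHom_of_total hM.prop.2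
    (IsQuadraticModule.mem_or_neg_mem_of_maximal hM)
  exact ⟨φ, fun a ha => hφ a (hPM ha)⟩

/-- Start from `f + N ∈ Q`. Multiplying `f + r` by `(k - s)²` and correcting with bounded terms
lowers `r ≥ 0` by `1 / k²`, with `k` independent of `r`, so `N k²` steps reach `r = 0`. -/
theorem mem_of_isSumSq_mul_sub_one_mem (hQ : IsArchimedeanQuadraticModule Q) {f s : A}
    (hs : IsSumSq s) (h : s * f - 1 ∈ Q) : f ∈ Q := by
  obtain ⟨N, hN⟩ := hQ.exists_natCast_sub_mem (-f)
  obtain ⟨k₁, hk₁⟩ := hQ.exists_natCast_sub_mem s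
  obtain ⟨k₂, hk₂⟩ := hQ.exists_natCast_sub_mem (s ^ 2 * f)
  obtain ⟨k, hk, hks, hksf⟩ : ∃ k : ℕ, 0 < k ∧ 2 * (k : A) - s ∈ Q ∧
      2 * (k : A) - 1 - s ^ 2 * f ∈ Q := by
    refine ⟨k₁ + k₂ + 1, by positivity, ?_, ?_⟩
    · have := hQ.1.add_mem hk₁ (hQ.1.natCast_mem (k₁ + 2 * k₂ + 2))
      convert this using 1
      push_cast
      ring
    · have := hQ.1.add_mem hk₂ (hQ.1.natCast_mem (2 * k₁ + k₂ + 1))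
      convert this using 1
      push_cast
      ring
  have hk' : (0 : ℝ) < (k : ℝ) ^ 2 := by positivity
  have step : ∀ r : ℝ, 0 ≤ r → f + algebraMap ℝ A r ∈ Q →
      f + algebraMap ℝ A (r - 1 / (k : ℝ) ^ 2) ∈ Q := by
    intro r hr hf
    refine hQ.1.mem_of_algebraMap_mul_mem hk' ?_
    have e : algebraMap ℝ A ((k : ℝ) ^ 2) * (f + algebraMap ℝ A (r - 1 / (k : ℝ) ^ 2))
        = ((k : A) - s) ^ 2 * (f + algebraMap ℝ A r) + (((2 * k : ℕ) : A) * (s * f - 1)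
          + (algebraMap ℝ A r * (s * (2 * (k : A) - s))
          + (2 * (k : A) - 1 - s ^ 2 * f))) := by
      rw [mul_add, ← map_mul, mul_sub, mul_one_div_cancel hk'.ne']
      simp only [map_sub, map_mul, map_pow, map_natCast, map_one, Nat.cast_mul, Nat.cast_ofNat]
      ring
    rw [e]
    exact hQ.1.add_mem (hQ.1.sq_mul_mem _ hf) (hQ.1.add_mem (hQ.1.natCast_mul_mem _ h)
      (hQ.1.add_mem (hQ.1.algebraMap_mul_mem hr (hQ.1.isSumSq_mul_mem hs hks)) hksf))
  have iter : ∀ j : ℕ, j ≤ N * k ^ 2 → f + algebraMap ℝ A (N - j / (k : ℝ) ^ 2) ∈ Q := by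
    intro j
    induction j with
    | zero =>
      intro _
      convert hN using 1
      simp
      ring
    | succ j ih =>
      intro hj
      have hr : (0 : ℝ) ≤ N - j / (k : ℝ) ^ 2 := by
        rw [sub_nonneg, div_le_iff₀ hk']
        exact_mod_cast (Nat.le_succ j).trans hj
      convert step _ hr (ih ((Nat.le_succ j).trans hj)) using 3
      push_cast
      ring
  have := iter (N * k ^ 2) le_rfl
  rw [Nat.cast_mul, Nat.cast_pow, mul_div_cancel_right₀ _ hk'.ne'] at this
  simpa using this

/-- Jacobi's representation theorem for archimedean quadratic modules. -/
theorem mem_of_forall_pos (hQ : IsArchimedeanQuadraticModule Q) {f : A}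
    (hf : ∀ φ : A →ₐ[ℝ] ℝ, (∀ a ∈ Q, 0 ≤ φ a) → 0 < φ f) : f ∈ Q := by
  have h1 : (-1 : A) ∈ {x | ∃ q ∈ Q, ∃ s, IsSumSq s ∧ x = q + s * (-f)} := by
    by_contra hcon
    have hsub : Q ⊆ {x | ∃ q ∈ Q, ∃ s, IsSumSq s ∧ x = q + s * (-f)} :=
      fun q hq => ⟨q, hq, 0, IsSumSq.zero, by simp⟩
    obtain ⟨φ, hφ⟩ := hQ.exists_ringHom (hQ.1.adjoin (-f)) hsub hcon
    have hpos := hf φ fun a ha => hφ a (hsub ha)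
    have hnonneg := hφ (-f) ⟨0, hQ.1.zero_mem, 1, by simp, by simp⟩
    rw [map_neg] at hnonneg
    linarith
  obtain ⟨q, hq, s, hs, h⟩ := h1
  refine hQ.mem_of_isSumSq_mul_sub_one_mem hs ?_
  have e : s * f - 1 = q := by linear_combination h
  rwa [e]

end IsArchimedeanQuadraticModule

/-! ### Boundedness in integral extensions -/

section Integral

variable {A : Type*} [CommRing A] [Algebra ℝ A] {Q : Set A}

/-- Cauchy–Schwarz via Lagrange's identity; ordered pairs count each difference twice, whence the
factor 2. -/
theorem IsQuadraticModule.card_mul_sum_sq_sub_sq_sum_mem (hQ : IsQuadraticModule Q) (n : ℕ)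
    (x : ℕ → A) :
    (n : A) * ∑ i ∈ Finset.range n, x i ^ 2 - (∑ i ∈ Finset.range n, x i) ^ 2 ∈ Q := by
  refine hQ.mem_of_algebraMap_mul_mem (r := 2) two_pos ?_
  have e : algebraMap ℝ A 2 *
      ((n : A) * ∑ i ∈ Finset.range n, x i ^ 2 - (∑ i ∈ Finset.range n, x i) ^ 2)
      = ∑ i ∈ Finset.range n, ∑ j ∈ Finset.range n, (x i - x j) ^ 2 := by
    simp only [sub_sq, Finset.sum_add_distrib, Finset.sum_sub_distrib, Finset.sum_const,
      Finset.card_range, nsmul_eq_mul, ← Finset.mul_sum, ← Finset.sum_mul, map_ofNat]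
    ring
  rw [e]
  exact hQ.sum_mem fun i _ => hQ.sum_mem fun j _ => hQ.sq_mem _

theorem IsQuadraticModule.one_sub_sq_mem (hQ : IsQuadraticModule Q) {n : ℕ} (hn : 0 < n) {g : A}
    (h : ∑ i ∈ Finset.range n, (g ^ 2) ^ i - (n : A) * (g ^ 2) ^ n ∈ Q) : 1 - g ^ 2 ∈ Q := by
  -- With `u = g²`, this is Bernoulli's inequality: `(u - 1)(u ^ m - 1)` is `(u - 1)²` times a sum
  -- of squares. Summed over `i` with `k = n - i` and added to `h`, it leaves a positive multiple of
  -- `1 - u`.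
  have hgeom : ∀ i k : ℕ, (g ^ 2) ^ (i + k) - (g ^ 2) ^ i - (k : A) * (g ^ 2 - 1) ∈ Q := by
    intro i k
    induction k with
    | zero => simpa using hQ.zero_mem
    | succ k ih =>
      have e : (g ^ 2) ^ (i + (k + 1)) - (g ^ 2) ^ i - ((k + 1 : ℕ) : A) * (g ^ 2 - 1)
          = ((g ^ 2) ^ (i + k) - (g ^ 2) ^ i - (k : A) * (g ^ 2 - 1))
            + (g ^ 2 - 1) ^ 2 * ∑ j ∈ Finset.range (i + k), (g ^ j) ^ 2 := by
        have hg := geom_sum_mul (g ^ 2) (i + k)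
        have hs : ∑ j ∈ Finset.range (i + k), (g ^ j) ^ 2
            = ∑ j ∈ Finset.range (i + k), (g ^ 2) ^ j :=
          Finset.sum_congr rfl fun j _ => by rw [← pow_mul, ← pow_mul, mul_comm]
        rw [hs]
        push_cast
        rw [← add_assoc, pow_succ (g ^ 2) (i + k)]
        linear_combination (-(g ^ 2 - 1)) * hg
      rw [e]
      exact hQ.add_mem ih (hQ.sq_mul_mem _ (hQ.sum_mem fun j _ => hQ.sq_mem _))
  have hsum : ∑ i ∈ Finset.range n,
      ((g ^ 2) ^ n - (g ^ 2) ^ i - ((n - i : ℕ) : A) * (g ^ 2 - 1)) ∈ Q := by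
    refine hQ.sum_mem fun i hi => ?_
    have := hgeom i (n - i)
    rwa [Nat.add_sub_cancel' (Finset.mem_range.1 hi).le] at this
  have hpos : 0 < ∑ i ∈ Finset.range n, (n - i) :=
    Finset.sum_pos (fun i hi => Nat.sub_pos_of_lt (Finset.mem_range.1 hi))
      (Finset.nonempty_range_iff.2 hn.ne')
  refine hQ.mem_of_algebraMap_mul_mem
    (r := ((∑ i ∈ Finset.range n, (n - i) : ℕ) : ℝ)) (by exact_mod_cast hpos) ?_
  convert hQ.add_mem hsum h using 1
  simp only [Finset.sum_sub_distrib, Finset.sum_const, Finset.card_range, nsmul_eq_mul,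
    ← Finset.sum_mul, map_natCast]
  rw [Nat.cast_sum]
  ring

/-- An element is bounded if some power of it is a combination of lower powers with bounded
coefficients. -/
theorem IsQuadraticModule.exists_natCast_sub_sq_mem (hQ : IsQuadraticModule Q) {n : ℕ}
    (hn : 0 < n) {a : A} {c : ℕ → A} (hc : ∀ i, ∃ N : ℕ, (N : A) - c i ^ 2 ∈ Q)
    (ha : a ^ n = ∑ i ∈ Finset.range n, c i * a ^ i) : ∃ N : ℕ, (N : A) - a ^ 2 ∈ Q := by
  choose N hN using hc
  -- Cauchy–Schwarz gives `a^(2n) ≤ n ∑ cᵢ² a^(2i) ≤ M ∑ a^(2i)`. Rescaling to `g = a / k` with `k²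
  -- ≥ n M` and `k ≥ 1` makes `n g^(2n) ≤ ∑ g^(2i)`.
  set M : ℕ := n * ∑ i ∈ Finset.range n, N i with hM
  set k : ℕ := n * M + 1 with hk
  have hbound : (M : A) * ∑ i ∈ Finset.range n, (a ^ 2) ^ i - (a ^ 2) ^ n ∈ Q := by
    have h₁ := hQ.card_mul_sum_sq_sub_sq_sum_mem n fun i => c i * a ^ i
    rw [← ha] at h₁
    have h₂ : ∑ i ∈ Finset.range n, (a ^ i) ^ 2 * ((N i : A) - c i ^ 2) ∈ Q :=
      hQ.sum_mem fun i _ => hQ.sq_mul_mem _ (hN i)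
    have h₃ : ∑ i ∈ Finset.range n,
        (a ^ i) ^ 2 * (((∑ j ∈ Finset.range n, N j) - N i : ℕ) : A) ∈ Q :=
      hQ.sum_mem fun i _ => hQ.sq_mul_mem _ (hQ.natCast_mem _)
    convert hQ.add_mem h₁ (hQ.natCast_mul_mem n (hQ.add_mem h₂ h₃)) using 1
    rw [← Finset.sum_add_distrib, hM, Nat.cast_mul]
    have e : ∀ i ∈ Finset.range n, (a ^ i) ^ 2 * ((N i : A) - c i ^ 2)
        + (a ^ i) ^ 2 * (((∑ j ∈ Finset.range n, N j) - N i : ℕ) : A)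
        = ((∑ j ∈ Finset.range n, N j : ℕ) : A) * (a ^ 2) ^ i - (c i * a ^ i) ^ 2 := by
      intro i hi
      rw [Nat.cast_sub (Finset.single_le_sum (fun j _ => Nat.zero_le (N j)) hi)]
      ring
    rw [Finset.sum_congr rfl e, Finset.sum_sub_distrib, ← Finset.mul_sum]
    ring
  have hk0 : (0 : ℝ) < k := by positivity
  have hk' : (1 : ℝ) ≤ k := by exact_mod_cast Nat.le_add_left 1 (n * M)
  have hk1 : (1 : ℝ) ≤ (k : ℝ) ^ 2 := one_le_pow₀ hk'
  set g : A := algebraMap ℝ A (k : ℝ)⁻¹ * a with hg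
  have hga : a = algebraMap ℝ A k * g := by
    rw [hg, ← mul_assoc, ← map_mul, mul_inv_cancel₀ hk0.ne', map_one, one_mul]
  have hgQ : 1 - g ^ 2 ∈ Q := by
    refine hQ.one_sub_sq_mem hn ?_
    refine hQ.mem_of_algebraMap_mul_mem (r := ((k : ℝ) ^ 2) ^ n) (by positivity) ?_
    have h₁ := hQ.natCast_mul_mem n hbound
    have h₂ : ∑ i ∈ Finset.range n, algebraMap ℝ A
        (((k : ℝ) ^ 2) ^ n - n * M * ((k : ℝ) ^ 2) ^ i) * (g ^ i) ^ 2 ∈ Q := by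
      refine hQ.sum_mem fun i hi => hQ.algebraMap_mul_mem ?_ (hQ.sq_mem _)
      rw [sub_nonneg]
      have hle : (n : ℝ) * M ≤ (k : ℝ) ^ 2 := by
        have : (n : ℝ) * M ≤ k := by rw [hk]; push_cast; linarith
        nlinarith
      calc (n : ℝ) * M * ((k : ℝ) ^ 2) ^ i ≤ (k : ℝ) ^ 2 * ((k : ℝ) ^ 2) ^ i := by gcongr
        _ = ((k : ℝ) ^ 2) ^ (i + 1) := by ring
        _ ≤ ((k : ℝ) ^ 2) ^ n := pow_le_pow_right₀ hk1 (Finset.mem_range.1 hi)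
    convert hQ.add_mem h₁ h₂ using 1
    have e : ∀ i ∈ Finset.range n, algebraMap ℝ A
        (((k : ℝ) ^ 2) ^ n - n * M * ((k : ℝ) ^ 2) ^ i) * (g ^ i) ^ 2
        = ((k : A) ^ 2) ^ n * (g ^ 2) ^ i - n * M * (a ^ 2) ^ i := by
      intro i _
      rw [hga]
      simp only [map_sub, map_mul, map_pow, map_natCast]
      ring
    rw [Finset.sum_congr rfl e, Finset.sum_sub_distrib, ← Finset.mul_sum, ← Finset.mul_sum]
    have e2 : (a ^ 2) ^ n = ((k : A) ^ 2) ^ n * (g ^ 2) ^ n := by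
      rw [hga, map_natCast]
      ring
    rw [e2]
    simp only [map_pow, map_natCast]
    ring
  refine ⟨k ^ 2, ?_⟩
  convert hQ.sq_mul_mem (k : A) hgQ using 1
  rw [hga, map_natCast]
  push_cast
  ring

/-- A quadratic module in an integral extension is archimedean if it contains an archimedean
quadratic module of the base ring. -/
theorem IsArchimedeanQuadraticModule.of_isIntegral {B : Type*} [CommRing B] [Algebra B A]
    [Algebra.IsIntegral B A] {P : Set B} (hP : IsArchimedeanQuadraticModule P)
    (hQ : IsQuadraticModule Q) (hPQ : ∀ b ∈ P, algebraMap B A b ∈ Q) :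
    IsArchimedeanQuadraticModule Q := by
  refine ⟨hQ, fun a => ?_⟩
  -- In the zero ring (`t = 0`) the monic equation could have degree 0.
  rcases subsingleton_or_nontrivial A with _ | _
  · exact ⟨0, by rw [Subsingleton.elim (((0 : ℕ) : A) - a ^ 2) 0]; exact hQ.zero_mem⟩
  have : Nontrivial B := (algebraMap B A).domain_nontrivial
  obtain ⟨p, hp, hpa⟩ := Algebra.IsIntegral.isIntegral (R := B) a
  have hdeg : 0 < p.natDegree := by
    rw [Nat.pos_iff_ne_zero]
    intro h0
    rw [hp.natDegree_eq_zero.1 h0] at hpa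
    simp at hpa
  refine hQ.exists_natCast_sub_sq_mem hdeg (c := fun i => -algebraMap B A (p.coeff i)) ?_ ?_
  · intro i
    obtain ⟨N, hN⟩ := hP.2 (p.coeff i)
    exact ⟨N, by simpa using hPQ _ hN⟩
  · rw [Polynomial.eval₂_eq_sum_range, Finset.sum_range_succ, hp.coeff_natDegree, map_one,
      one_mul] at hpa
    simp only [neg_mul, Finset.sum_neg_distrib]
    linear_combination hpa

end Integral

/-! ### The ring `ℝ[X, f]` and its real points -/

theorem isQuadraticModule_quadraticModuleGeneratedBy {A : Type*} [CommRing A] (G : Set A) :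
    IsQuadraticModule (quadraticModuleGeneratedBy G) :=
  (isLeast_quadraticModuleGeneratedBy G).1.1

theorem algebraMap_mem_quadraticModuleGeneratedBy_image {A B : Type*} [CommRing A] [CommRing B]
    [Algebra B A] {G : Set B} {b : B} (hb : b ∈ quadraticModuleGeneratedBy G) :
    algebraMap B A b ∈ quadraticModuleGeneratedBy (algebraMap B A '' G) := by
  obtain ⟨N, p, g, hg, rfl⟩ := hb
  refine ⟨N, fun i => algebraMap B A (p i), fun i => algebraMap B A (g i), fun i => ?_, by simp⟩
  rcases hg i with h | h
  · left
    simp [Set.mem_singleton_iff.1 h]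
  · exact Or.inr ⟨g i, h, rfl⟩

theorem isIntegral_polyRingAdjoin {n t : ℕ}
    (f : Matrix (Fin t) (Fin t) (MvPolynomial (Fin n) ℝ)) :
    Algebra.IsIntegral (MvPolynomial (Fin n) ℝ) (polyRingAdjoin f) := by
  refine ⟨fun a => ?_⟩
  rw [← isIntegral_algHom_iff (polyRingAdjoin f).val Subtype.val_injective]
  exact Matrix.isIntegral _

/-- A real point of `ℝ[X, f]` lying over `x` sends `f` to an eigenvalue of `f(x)`. -/
theorem hasEigenvalue_evalMatrix {n t : ℕ}
    (f : Matrix (Fin t) (Fin t) (MvPolynomial (Fin n) ℝ)) (φ : polyRingAdjoin f →+* ℝ)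
    (x : Fin n → ℝ)
    (hx : ∀ p, φ (algebraMap (MvPolynomial (Fin n) ℝ) (polyRingAdjoin f) p)
      = MvPolynomial.eval x p) :
    Module.End.HasEigenvalue (Matrix.toLin' (evalMatrix f x))
      (φ ⟨f, Algebra.self_mem_adjoin_singleton (MvPolynomial (Fin n) ℝ) f⟩) := by
  set F : polyRingAdjoin f := ⟨f, Algebra.self_mem_adjoin_singleton (MvPolynomial (Fin n) ℝ) f⟩
    with hF
  have h0 : Polynomial.aeval F f.charpoly = 0 := by
    apply Subtype.val_injective
    have := Polynomial.aeval_algHom_apply (polyRingAdjoin f).val F f.charpoly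
    rw [show (polyRingAdjoin f).val F = f from rfl, Matrix.aeval_self_charpoly] at this
    exact this.symm
  rw [Module.End.hasEigenvalue_iff_isRoot_charpoly, Matrix.charpoly_toLin', evalMatrix,
    Matrix.charpoly_map, Polynomial.IsRoot, Polynomial.eval_map]
  have := congrArg φ h0
  rw [map_zero, Polynomial.aeval_def, Polynomial.hom_eval₂] at this
  rw [← this]
  congr 1
  exact RingHom.ext fun p => (hx p).symm

theorem theorem19 {n t : ℕ} (G : Set (MvPolynomial (Fin n) ℝ))
    (hG : IsArchimedeanQuadraticModule (quadraticModuleGeneratedBy G))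
    (f : Matrix (Fin t) (Fin t) (MvPolynomial (Fin n) ℝ))
    (hf : ∀ x ∈ nonnegSet G, ∀ r : ℝ,
      Module.End.HasEigenvalue (Matrix.toLin' (evalMatrix f x)) r → 0 < r) :
    (⟨f, Algebra.self_mem_adjoin_singleton (MvPolynomial (Fin n) ℝ) f⟩ : polyRingAdjoin f) ∈
      quadraticModuleAdjoin G f := by
  have := isIntegral_polyRingAdjoin f
  have hQ : IsArchimedeanQuadraticModule (quadraticModuleAdjoin G f) :=
    hG.of_isIntegral (isQuadraticModule_quadraticModuleGeneratedBy _)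
      fun _ hb => algebraMap_mem_quadraticModuleGeneratedBy_image hb
  refine hQ.mem_of_forall_pos fun φ hφ => ?_
  -- The point of `ℝⁿ` under `φ`; it lies in `S_G` because `φ` is nonnegative on the image of `G`.
  let ψ : MvPolynomial (Fin n) ℝ →ₐ[ℝ] ℝ := φ.comp (Algebra.algHom ℝ _ (polyRingAdjoin f))
  let x : Fin n → ℝ := fun i => ψ (MvPolynomial.X i)
  have hx : ∀ p, φ (algebraMap (MvPolynomial (Fin n) ℝ) (polyRingAdjoin f) p)
      = MvPolynomial.eval x p := by
    intro p
    change ψ p = MvPolynomial.aeval x p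
    congr 1
    ext i
    simp [x]
  refine hf x (fun g hg => ?_) _ (hasEigenvalue_evalMatrix f φ.toRingHom x hx)
  rw [← hx]
  exact hφ _ ((isLeast_quadraticModuleGeneratedBy _).1.2 ⟨g, hg, rfl⟩)
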